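/- All graphs are finite, simple and undirected. Let $N_G(v)$ denote the neighborhood of a vertex $v$ in a graph $G$, and $G+H$ the disjoint union of $G$ and $H$. A set $S$ of vertices of a graph $G=(V,E)$ is *total dominating* if every vertex of $G$ has a neighbor in $S$. The graph $G$ is *total domishold* if there are weights $w:V\to\mathbb{R}_{\ge 0}$ and a threshold $t\in\mathbb{R}_{\ge 0}$ such that for every $S\subseteq V$, $\sum_{x\in S}w(x)\ge t$ if and only if $S$ is a total dominating set of $G$; it is *hereditary total domishold* if every induced subgraph of $G$ is total domishold. The *neighborhood function* of $G$ is $f_G:\{0,1\}^V\to\{0,1\}$, $f_G(x)=\bigvee_{v\in V}\bigwedge_{u\in N_G(v)}x_u$ (an empty conjunction equals $1$, an empty disjunction $0$). A Boolean function $f:\{0,1\}^V\to\{0,1\}$ is *$2$-asummable* if there are no (not necessarily distinct) $x^1,x^2$ with $f(x^1)=f(x^2)=0$ and $y^1,y^2$ with $f(y^1)=f(y^2)=1$ such that $x^1+x^2=y^1+y^2$ in $\mathbb{Z}^V$. The graph $G$ is *hereditary $2$-asummable* if the neighborhood function of every induced subgraph of $G$ is $2$-asummable. Let $F_1=C_4$,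 $F_2=C_5$, $F_3=C_6$, $F_4=P_6$, $F_5=2P_3$, $F_6=P_3+K_3$, $F_7=2K_3$ (where $C_n,P_n,K_n$ are the cycle, path and complete graph on $n$ vertices), and let $F_8,\dots,F_{13}$ be the graphs with vertex set $\{u,v,a,b,c,d\}$ whose edges are $ua,ub,vc,vd$ together with - $F_8$: $ac,\ ab$; - $F_9$: $ac,\ bc,\ ab$; - $F_{10}$: $ac,\ ab,\ cd$; - $F_{11}$: $ac,\ bc,\ ab,\ cd$; - $F_{12}$: $ac,\ bc,\ bd,\ ab,\ cd$; - $F_{13}$: $ac,\ ad,\ bc,\ bd,\ ab,\ cd$. **Theorem.** For every graph $G$, the following are equivalent: 1. $G$ is hereditary total domishold. 2. $G$ is hereditary $2$-asummable. 3. $G$ is $\{F_1,\dots,F_{13}\}$-free, that is, no induced subgraph of $G$ is isomorphic to one of $F_1,\dots,F_{13}$. -/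

import Mathlib

namespace TotalDomishold

open SimpleGraph

/-- `S` is a total dominating set of `G`: every vertex of `G` has a neighbor in `S`. -/
def IsTotalDominating {V : Type*} (G : SimpleGraph V) (S : Finset V) : Prop :=
  ∀ v, ∃ u ∈ S, G.Adj v u

/-- A finite graph is total domishold if there are non-negative real vertex weights `w` and a
non-negative real threshold `t` such that the vertex sets of weight at least `t` are exactly
the total dominating sets. -/
def IsTotalDomishold {V : Type*} [Finite V] (G : SimpleGraph V) : Prop :=
  ∃ (w : V → ℝ) (t : ℝ), (∀ v, 0 ≤ w v) ∧ 0 ≤ t ∧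
    ∀ S : Finset V, t ≤ ∑ v ∈ S, w v ↔ IsTotalDominating G S

/-- Every induced subgraph is total domishold. -/
def IsHereditaryTotalDomishold {V : Type*} [Finite V] (G : SimpleGraph V) : Prop :=
  ∀ s : Set V, IsTotalDomishold (G.induce s)

open Classical in
/-- The neighborhood function `f_G(x) = ⋁_v ⋀_{u ∈ N(v)} x_u`. -/
noncomputable def neighborhoodFunction {V : Type*} (G : SimpleGraph V) : (V → Bool) → Bool :=
  fun x => decide (∃ v, ∀ u ∈ G.neighborSet v, x u = true)

/-- A Boolean function is `k`-summable if, for some `2 ≤ r ≤ k`, there are `r` false points and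
`r` true points (repetitions allowed) with the same sum, taken coordinatewise in the integers. -/
def IsSummable {V : Type*} (k : ℕ) (f : (V → Bool) → Bool) : Prop :=
  ∃ r : ℕ, 2 ≤ r ∧ r ≤ k ∧ ∃ x y : Fin r → V → Bool,
    (∀ i, f (x i) = false) ∧ (∀ i, f (y i) = true) ∧
      ∀ v, ∑ i, (x i v).toNat = ∑ i, (y i v).toNat

/-- A Boolean function is `k`-asummable if it is not `k`-summable. -/
def IsAsummable {V : Type*} (k : ℕ) (f : (V → Bool) → Bool) : Prop :=
  ¬ IsSummable k f

/-- Every induced subgraph has a 2-asummable neighborhood function. -/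
def IsHereditaryTwoAsummable {V : Type*} (G : SimpleGraph V) : Prop :=
  ∀ s : Set V, IsAsummable 2 (neighborhoodFunction (G.induce s))

/-- `P_6` (path `0 1 2 3 4 5`) with the chord `02`: a triangle with a path attached. -/
def F8 : SimpleGraph (Fin 6) :=
  fromEdgeSet {s(0, 1), s(1, 2), s(2, 3), s(3, 4), s(4, 5), s(0, 2)}

/-- The diamond on `0, 1, 2, 3` (with `0` and `3` non-adjacent) and the path `3 4 5` attached
at the degree-two vertex `3`. -/
def F9 : SimpleGraph (Fin 6) :=
  fromEdgeSet {s(0, 1), s(0, 2), s(1, 2), s(1, 3), s(2, 3), s(3, 4), s(4, 5)}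

/-- `P_6` with the chords `02` and `35`: two disjoint triangles joined by one edge. -/
def F10 : SimpleGraph (Fin 6) :=
  fromEdgeSet {s(0, 1), s(1, 2), s(2, 3), s(3, 4), s(4, 5), s(0, 2), s(3, 5)}

/-- The diamond on `0, 1, 2, 3` (with `0` and `3` non-adjacent) and the triangle `3 4 5`, sharing
the vertex `3`. -/
def F11 : SimpleGraph (Fin 6) :=
  fromEdgeSet {s(0, 1), s(0, 2), s(1, 2), s(1, 3), s(2, 3), s(3, 4), s(4, 5), s(3, 5)}

/-- Two disjoint triangles `0 1 2` and `3 4 5` joined by the three edges `13`, `23`, `24`: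
the square of the path `0 1 2 3 4 5`. -/
def F12 : SimpleGraph (Fin 6) :=
  fromEdgeSet {s(0, 1), s(0, 2), s(1, 2), s(1, 3), s(2, 3), s(2, 4), s(3, 4), s(3, 5), s(4, 5)}

/-- The complete graph on `1, 2, 3, 4`, a vertex `0` adjacent to exactly `1, 2`, and a vertex `5`
adjacent to exactly `3, 4`. -/
def F13 : SimpleGraph (Fin 6) :=
  fromEdgeSet {s(1, 2), s(1, 3), s(1, 4), s(2, 3), s(2, 4), s(3, 4),
    s(0, 1), s(0, 2), s(3, 5), s(4, 5)}

/-- The forbidden graphs `F_1, …, F_13`: `C_4`, `C_5`, `C_6`, `P_6`, `2P_3`, `P_3 + K_3`, `2K_3`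
and the six graphs above. -/
def forbidden : Fin 13 → Σ W : Type, SimpleGraph W :=
  ![⟨Fin 4, cycleGraph 4⟩, ⟨Fin 5, cycleGraph 5⟩, ⟨Fin 6, cycleGraph 6⟩, ⟨Fin 6, pathGraph 6⟩,
    ⟨Fin 3 ⊕ Fin 3, pathGraph 3 ⊕g pathGraph 3⟩,
    ⟨Fin 3 ⊕ Fin 3, pathGraph 3 ⊕g completeGraph (Fin 3)⟩,
    ⟨Fin 3 ⊕ Fin 3, completeGraph (Fin 3) ⊕g completeGraph (Fin 3)⟩,
    ⟨Fin 6, F8⟩, ⟨Fin 6, F9⟩, ⟨Fin 6, F10⟩, ⟨Fin 6, F11⟩, ⟨Fin 6, F12⟩, ⟨Fin 6, F13⟩]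

/-- `G` has no induced subgraph isomorphic to a member of the family `F`. -/
def IsFree {V : Type*} {ι : Type*} (F : ι → Σ W : Type, SimpleGraph W) (G : SimpleGraph V) : Prop :=
  ∀ i, ¬ (F i).2.IsIndContained G

end TotalDomishold

namespace TotalDomishold

open SimpleGraph

/-! ### Total domishold graphs have 2-asummable neighborhood functions -/

/-! A set is total dominating exactly when its complement contains no neighborhood, so total
domishold means that `neighborhoodFunction G` is a threshold function of the complement. Threshold
functions are asummable, and each forbidden graph carries an explicit 2-summability certificate;
this gives the implications from domishold to free.

The substance is the converse. Freeness passes to induced subgraphs, so it suffices that a free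
graph is total domishold. Its inclusion-minimal neighborhoods form a 1-Sperner family
(`IsFree.isOneSperner_minimalNeighborhoods`): two minimal neighborhoods with two private elements
each would produce a forbidden graph, by `IsFree.not_privatePairs` if their centers are non-adjacent
and by `IsFree.not_long_path` if they are adjacent. Every 1-Sperner family is threshold
(`IsOneSperner.exists_separates`): a splitting vertex cuts it into two smaller families, whose
weights are glued. Complementing the resulting weight condition gives the domishold weights. -/

theorem neighborhoodFunction_eq_true_iff {V : Type*} (G : SimpleGraph V) (x : V → Bool) :
    neighborhoodFunction G x = true ↔ ∃ v, ∀ u, G.Adj v u → x u = true := by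
  simp [neighborhoodFunction]

theorem neighborhoodFunction_eq_false_iff {V : Type*} (G : SimpleGraph V) (x : V → Bool) :
    neighborhoodFunction G x = false ↔ ∀ v, ∃ u, G.Adj v u ∧ x u = false := by
  simp [neighborhoodFunction]

theorem isTotalDominating_filter_iff {V : Type*} [Fintype V] (G : SimpleGraph V) (x : V → Bool) :
    IsTotalDominating G {v | x v = false} ↔ neighborhoodFunction G x = false := by
  simp [neighborhoodFunction_eq_false_iff, IsTotalDominating, and_comm]

/-- Zero sets of false points are total dominating and weigh at least `t`; zero sets of true points
weigh less. Equal coordinate sums would make the two total weights equal. -/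
theorem IsTotalDomishold.isAsummable {V : Type*} [Finite V] {G : SimpleGraph V}
    (h : IsTotalDomishold G) (k : ℕ) : IsAsummable k (neighborhoodFunction G) := by
  have := Fintype.ofFinite V
  obtain ⟨w, t, -, -, hS⟩ := h
  rintro ⟨r, hr, -, x, y, hx, hy, hxy⟩
  have hsum (z : V → Bool) : ∑ v with z v = false, w v = ∑ v, w v * (1 - ((z v).toNat : ℝ)) := by
    rw [Finset.sum_filter]
    refine Finset.sum_congr rfl fun v _ => ?_
    cases z v <;> simp
  have key : ∑ i, ∑ v with x i v = false, w v = ∑ i, ∑ v with y i v = false, w v := by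
    simp only [hsum]
    rw [Finset.sum_comm, Finset.sum_comm (s := Finset.univ (α := Fin r))]
    refine Finset.sum_congr rfl fun v _ => ?_
    rw [← Finset.mul_sum, ← Finset.mul_sum, Finset.sum_sub_distrib, Finset.sum_sub_distrib,
      ← Nat.cast_sum, ← Nat.cast_sum, hxy v]
  have : Nonempty (Fin r) := ⟨⟨0, by omega⟩⟩
  have hlt : ∑ i, ∑ v with y i v = false, w v < ∑ i, ∑ v with x i v = false, w v := by
    refine Finset.sum_lt_sum_of_nonempty Finset.univ_nonempty fun i _ => ?_
    have h1 := (hS _).2 ((isTotalDominating_filter_iff G (x i)).2 (hx i))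
    have h2 : ¬ t ≤ ∑ v with y i v = false, w v := by
      rw [hS, isTotalDominating_filter_iff, hy i]
      simp
    linarith
  exact hlt.ne key.symm

/-! ### Hereditarily 2-asummable graphs contain no forbidden graph -/

theorem IsAsummable.neighborhoodFunction_of_iso {V W : Type*} {G : SimpleGraph V}
    {H : SimpleGraph W} (e : H ≃g G) {k : ℕ} (h : IsAsummable k (neighborhoodFunction G)) :
    IsAsummable k (neighborhoodFunction H) := by
  rintro ⟨r, hr, hrk, x, y, hx, hy, hxy⟩
  have hf (z : W → Bool) : neighborhoodFunction G (z ∘ e.symm) = neighborhoodFunction H z := by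
    rw [Bool.eq_iff_iff, neighborhoodFunction_eq_true_iff, neighborhoodFunction_eq_true_iff]
    constructor
    · rintro ⟨v, hv⟩
      refine ⟨e.symm v, fun u hu => ?_⟩
      have := hv (e u) (by rw [← e.symm.map_adj_iff]; simpa using hu)
      simpa using this
    · rintro ⟨v, hv⟩
      refine ⟨e v, fun u hu => hv _ ?_⟩
      rw [← e.map_adj_iff]
      simpa using hu
  exact h ⟨r, hr, hrk, fun i => x i ∘ e.symm, fun i => y i ∘ e.symm,
    fun i => (hf _).trans (hx i), fun i => (hf _).trans (hy i), fun v => hxy (e.symm v)⟩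

theorem IsHereditaryTwoAsummable.of_isIndContained {V W : Type*} {G : SimpleGraph V}
    {H : SimpleGraph W} (h : IsHereditaryTwoAsummable G) (hHG : H.IsIndContained G) :
    IsAsummable 2 (neighborhoodFunction H) := by
  obtain ⟨f⟩ := hHG
  exact (h (Set.range f)).neighborhoodFunction_of_iso f.isoInduceRange

/-- Two neighborhoods contained in disjoint pairs `{a, b}` and `{c, d}`, where neither `{a, c}`
nor `{b, d}` contains a neighborhood, witness 2-summability. -/
theorem isSummable_of_disjoint_pairs {V : Type*} {H : SimpleGraph V} (u v a b c d : V)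
    (hab : a ≠ b) (hac : a ≠ c) (had : a ≠ d) (hbc : b ≠ c) (hbd : b ≠ d) (hcd : c ≠ d)
    (hu : ∀ x, H.Adj u x → x = a ∨ x = b) (hv : ∀ x, H.Adj v x → x = c ∨ x = d)
    (h₁ : ∀ w, ∃ x, H.Adj w x ∧ x ≠ a ∧ x ≠ c) (h₂ : ∀ w, ∃ x, H.Adj w x ∧ x ≠ b ∧ x ≠ d) :
    IsSummable 2 (neighborhoodFunction H) := by
  classical
  -- Both pairs of points sum to the indicator of `{a, b, c, d}`.
  refine ⟨2, le_rfl, le_rfl, ![fun x => decide (x = a ∨ x = c), fun x => decide (x = b ∨ x = d)],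
    ![fun x => decide (x = a ∨ x = b), fun x => decide (x = c ∨ x = d)], ?_, ?_, ?_⟩
  · simpa [Fin.forall_fin_two, neighborhoodFunction_eq_false_iff] using ⟨h₁, h₂⟩
  · simpa [Fin.forall_fin_two, neighborhoodFunction_eq_true_iff] using ⟨⟨u, hu⟩, ⟨v, hv⟩⟩
  · intro x
    by_cases ha : x = a <;> by_cases hb : x = b <;> by_cases hc : x = c <;> by_cases hd : x = d <;>
      simp_all

instance decidableRelPathGraphAdj (n : ℕ) : DecidableRel (pathGraph n).Adj :=
  fun _ _ => decidable_of_iff' _ pathGraph_adj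

instance decidableRelSumAdj {V W : Type*} (G : SimpleGraph V) (H : SimpleGraph W)
    [DecidableRel G.Adj] [DecidableRel H.Adj] : DecidableRel (G ⊕g H).Adj
  | .inl a, .inl b => inferInstanceAs (Decidable (G.Adj a b))
  | .inr a, .inr b => inferInstanceAs (Decidable (H.Adj a b))
  | .inl _, .inr _ => isFalse (by simp)
  | .inr _, .inl _ => isFalse (by simp)

instance : DecidableRel F8.Adj := by unfold F8; infer_instance
instance : DecidableRel F9.Adj := by unfold F9; infer_instance
instance : DecidableRel F10.Adj := by unfold F10; infer_instance
instance : DecidableRel F11.Adj := by unfold F11; infer_instance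
instance : DecidableRel F12.Adj := by unfold F12; infer_instance
instance : DecidableRel F13.Adj := by unfold F13; infer_instance

/-- Each graph has two degree-two vertices with disjoint neighborhoods `{a, b}` and `{c, d}`,
labeled so that the recombined pairs `{a, c}` and `{b, d}` contain no neighborhood. -/
theorem isSummable_forbidden (i : Fin 13) :
    IsSummable 2 (neighborhoodFunction (forbidden i).2) := by
  have hfin {n : ℕ} (H : SimpleGraph (Fin n)) [DecidableRel H.Adj] (u v a b c d : Fin n)
      (h : (a ≠ b ∧ a ≠ c ∧ a ≠ d ∧ b ≠ c ∧ b ≠ d ∧ c ≠ d) ∧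
        (∀ x, H.Adj u x → x = a ∨ x = b) ∧ (∀ x, H.Adj v x → x = c ∨ x = d) ∧
        (∀ w, ∃ x, H.Adj w x ∧ x ≠ a ∧ x ≠ c) ∧ (∀ w, ∃ x, H.Adj w x ∧ x ≠ b ∧ x ≠ d)) :
      IsSummable 2 (neighborhoodFunction H) := by
    obtain ⟨⟨h1, h2, h3, h4, h5, h6⟩, h7, h8, h9, h10⟩ := h
    exact isSummable_of_disjoint_pairs u v a b c d h1 h2 h3 h4 h5 h6 h7 h8 h9 h10
  fin_cases i
  · exact hfin (cycleGraph 4) 0 1 1 3 0 2 (by decide)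
  · exact hfin (cycleGraph 5) 0 1 1 4 2 0 (by decide)
  · exact hfin (cycleGraph 6) 0 1 1 5 0 2 (by decide)
  · exact hfin (pathGraph 6) 1 4 0 2 3 5 (by decide)
  · exact isSummable_of_disjoint_pairs (H := pathGraph 3 ⊕g pathGraph 3) (.inl 1) (.inr 1)
      (.inl 0) (.inl 2) (.inr 0) (.inr 2) (by decide) (by decide) (by decide) (by decide)
      (by decide) (by decide) (by decide) (by decide) (by decide) (by decide)
  · exact isSummable_of_disjoint_pairs (H := pathGraph 3 ⊕g completeGraph (Fin 3)) (.inl 1)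
      (.inr 0) (.inl 0) (.inl 2) (.inr 1) (.inr 2) (by decide) (by decide) (by decide) (by decide)
      (by decide) (by decide) (by decide) (by decide) (by decide) (by decide)
  · exact isSummable_of_disjoint_pairs (H := completeGraph (Fin 3) ⊕g completeGraph (Fin 3))
      (.inl 0) (.inr 0) (.inl 1) (.inl 2) (.inr 1) (.inr 2) (by decide) (by decide) (by decide)
      (by decide) (by decide) (by decide) (by decide) (by decide) (by decide) (by decide)
  · exact hfin F8 0 4 1 2 3 5 (by decide)
  · exact hfin F9 0 4 1 2 3 5 (by decide)
  · exact hfin F10 0 4 1 2 3 5 (by decide)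
  · exact hfin F11 0 4 1 2 3 5 (by decide)
  · exact hfin F12 0 5 1 2 3 4 (by decide)
  · exact hfin F13 0 5 1 2 3 4 (by decide)

theorem IsHereditaryTwoAsummable.isFree {V : Type*} {G : SimpleGraph V}
    (h : IsHereditaryTwoAsummable G) : IsFree forbidden G :=
  fun i hi => h.of_isIndContained hi (isSummable_forbidden i)

/-! ### 1-Sperner families are threshold -/

/-- Any two distinct members `e`, `f` satisfy `min {|e \ f|, |f \ e|} = 1`. -/
def IsOneSperner {V : Type*} [DecidableEq V] (A : Finset (Finset V)) : Prop :=
  ∀ e ∈ A, ∀ f ∈ A, e ≠ f → (e \ f).Nonempty ∧ ((e \ f).card ≤ 1 ∨ (f \ e).card ≤ 1)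

theorem IsOneSperner.mono {V : Type*} [DecidableEq V] {A B : Finset (Finset V)}
    (hB : IsOneSperner B) (h : A ⊆ B) : IsOneSperner A :=
  fun e he f hf => hB e (h he) f (h hf)

/-- The difference taken from the smaller set is the smaller of the two differences. -/
theorem IsOneSperner.card_sdiff_le_one {V : Type*} [DecidableEq V] {A : Finset (Finset V)}
    (hA : IsOneSperner A) {e f : Finset V} (he : e ∈ A) (hf : f ∈ A) (h : e.card ≤ f.card) :
    (e \ f).card ≤ 1 := by
  rcases eq_or_ne e f with rfl | hne
  · simp
  have h1 := Finset.card_sdiff_add_card_inter e f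
  have h2 := Finset.card_sdiff_add_card_inter f e
  rw [Finset.inter_comm] at h2
  rcases (hA e he f hf hne).2 with h' | h' <;> omega

/-- A 1-Sperner family with at least two members has a splitting vertex: a member through `z`
becomes a subset of every member avoiding `z` once `z` is deleted. -/
theorem IsOneSperner.exists_split {V : Type*} [DecidableEq V] {A : Finset (Finset V)}
    (hA : IsOneSperner A) (hcard : 1 < A.card) :
    ∃ z, (∃ e ∈ A, z ∈ e) ∧ (∃ f ∈ A, z ∉ f) ∧
      ∀ g ∈ A, z ∈ g → ∀ h ∈ A, z ∉ h → g.erase z ⊆ h := by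
  have hne : A.Nonempty := Finset.card_pos.1 (by omega)
  obtain ⟨e, he, hmin⟩ := A.exists_min_image Finset.card hne
  have hne' : (A.erase e).Nonempty := Finset.card_pos.1 (by rw [Finset.card_erase_of_mem he]; omega)
  -- Erasing `e` keeps `f` distinct from `e` even when all members have the same size.
  obtain ⟨f, hfA, hmax'⟩ := (A.erase e).exists_max_image Finset.card hne'
  obtain ⟨hfe, hf⟩ := Finset.mem_erase.1 hfA
  have hmax : ∀ g ∈ A, g.card ≤ f.card := fun g hg => by
    rcases eq_or_ne g e with rfl | hge
    · exact hmin f hf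
    · exact hmax' g (Finset.mem_erase.2 ⟨hge, hg⟩)
  have one {s t : Finset V} (h : (s \ t).card ≤ 1) {x y : V}
      (hx : x ∈ s) (hx' : x ∉ t) (hy : y ∈ s) (hyx : y ≠ x) : y ∈ t := by
    by_contra hy'
    exact hyx (Finset.card_le_one.1 h y (by simp [hy, hy']) x (by simp [hx, hx']))
  -- By extremality of `e` and `f`, deleting `z` puts `e` inside every member avoiding `z`, and
  -- every member through `z` inside `f`.
  obtain ⟨z, hz⟩ := (hA e he f hf hfe.symm).1
  obtain ⟨hze, hzf⟩ := Finset.mem_sdiff.1 hz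
  have hef := hA.card_sdiff_le_one he hf (hmin f hf)
  refine ⟨z, ⟨e, he, hze⟩, ⟨f, hf, hzf⟩, fun g hg hzg h hh hzh x hx => ?_⟩
  obtain ⟨hxz, hxg⟩ := Finset.mem_erase.1 hx
  have heh := hA.card_sdiff_le_one he hh (hmin h hh)
  have hgf := hA.card_sdiff_le_one hg hf (hmax g hg)
  have hgh : g ≠ h := fun H => hzh (H ▸ hzg)
  -- Now `z` and `x` both lie in `g \ h`, so `h \ g` has at most one element. An element `y` of `e \
  -- g` lies in both `h` and `f`, hence `h \ g = {y}` and `h ⊆ f`. This contradicts the antichain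
  -- property, or `x ∈ f` if `h = f`.
  by_contra hxh
  rcases eq_or_ne g e with rfl | hge
  · exact hxh (one heh hze hzh hxg hxz)
  obtain ⟨y, hy⟩ := (hA e he g hg hge.symm).1
  obtain ⟨hye, hyg⟩ := Finset.mem_sdiff.1 hy
  have hyz : y ≠ z := fun H => hyg (H ▸ hzg)
  have hyh := one heh hze hzh hye hyz
  have hyf := one hef hze hzf hye hyz
  have hhg : (h \ g).card ≤ 1 := by
    refine ((hA g hg h hh hgh).2).resolve_left fun H => ?_
    exact hxh (one H hzg hzh hxg hxz)
  have hsub : h ⊆ f := fun p hp => by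
    rcases eq_or_ne p y with rfl | hpy
    · exact hyf
    · exact one hgf hzg hzf (one hhg hyh hyg hp hpy) (fun H => hzh (H ▸ hp))
  rcases eq_or_ne h f with rfl | hhf
  · exact hxh (one hgf hzg hzh hxg hxz)
  · obtain ⟨p, hp⟩ := (hA h hh f hf hhf).1
    simp [hsub (Finset.mem_sdiff.1 hp).1] at hp

/-- The sets containing a member of `A` are those of weight at least `t`. -/
def Separates {V : Type*} (A : Finset (Finset V)) (w : V → ℕ) (t : ℕ) : Prop :=
  ∀ S : Finset V, (∃ e ∈ A, e ⊆ S) ↔ t ≤ ∑ v ∈ S, w v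

theorem separates_singleton {V : Type*} [DecidableEq V] (e : Finset V) :
    Separates {e} (fun v => if v ∈ e then 1 else 0) e.card := by
  intro S
  simp only [Finset.mem_singleton, exists_eq_left, Finset.sum_ite_mem, Finset.sum_const,
    smul_eq_mul, mul_one]
  constructor
  · intro h
    rw [Finset.inter_eq_right.2 h]
  · intro h
    exact Finset.inter_eq_right.1 (Finset.eq_of_subset_of_card_le Finset.inter_subset_right h)

/-- Threshold representations of the members through `z` and of the members avoiding `z` combine
into one for the whole family when `z` is a splitting vertex. -/
theorem IsOneSperner.exists_separates_of_split {V : Type*} [Fintype V] [DecidableEq V]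
    {A : Finset (Finset V)} (hA : IsOneSperner A) {z : V} (hz : ∃ e ∈ A, z ∈ e)
    (hsplit : ∀ g ∈ A, z ∈ g → ∀ h ∈ A, z ∉ h → g.erase z ⊆ h)
    {w₁ w₂ : V → ℕ} {t₁ t₂ : ℕ} (h₁ : Separates {e ∈ A | z ∈ e} w₁ t₁)
    (h₂ : Separates {e ∈ A | z ∉ e} w₂ t₂) : ∃ w t, Separates A w t := by
  set U : Finset V := (({e ∈ A | z ∈ e} : Finset (Finset V)).sup id).erase z with hU
  have hzU : z ∉ U := Finset.notMem_erase _ _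
  have hsubU : ∀ g ∈ A, z ∈ g → g.erase z ⊆ U := fun g hg hzg =>
    Finset.erase_subset_erase _ (Finset.le_sup (f := id) (Finset.mem_filter.2 ⟨hg, hzg⟩))
  have hUsub : ∀ h ∈ A, z ∉ h → U ⊆ h := by
    intro h hh hzh x hx
    obtain ⟨hxz, hx⟩ := Finset.mem_erase.1 hx
    obtain ⟨g, hg, hxg⟩ := Finset.mem_sup.1 hx
    obtain ⟨hg, hzg⟩ := Finset.mem_filter.1 hg
    exact hsplit g hg hzg h hh hzh (Finset.mem_erase.2 ⟨hxz, hxg⟩)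
  -- Were `w₁ x = 0`, deleting `x` from a member through `z` would leave its weight unchanged, so
  -- the rest would contain another member.
  have hpos : ∀ x ∈ U, 0 < w₁ x := by
    intro x hx
    obtain ⟨hxz, hx⟩ := Finset.mem_erase.1 hx
    obtain ⟨g, hg, hxg⟩ := Finset.mem_sup.1 hx
    have hle := (h₁ g).1 ⟨g, hg, subset_rfl⟩
    have hlt : ¬ t₁ ≤ ∑ v ∈ g.erase x, w₁ v := by
      rw [← h₁]
      rintro ⟨e, he, heg⟩
      have hxe : x ∉ e := fun H => Finset.notMem_erase x g (heg H)
      obtain ⟨p, hp⟩ := (hA e (Finset.mem_filter.1 he).1 g (Finset.mem_filter.1 hg).1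
        (fun H => hxe (H ▸ hxg))).1
      obtain ⟨hpe, hpg⟩ := Finset.mem_sdiff.1 hp
      exact hpg (Finset.mem_of_mem_erase (heg hpe))
    have := Finset.add_sum_erase g w₁ hxg
    omega
  have hz₁ (S : Finset V) (hzS : z ∈ S) :
      (∃ e ∈ A, z ∈ e ∧ e ⊆ S) ↔ t₁ - w₁ z ≤ ∑ v ∈ S ∩ U, w₁ v := by
    have := h₁ (insert z (S ∩ U))
    rw [Finset.sum_insert (by simp [hzU])] at this
    rw [Nat.sub_le_iff_le_add', ← this]
    refine exists_congr fun e => ?_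
    rw [Finset.mem_filter, and_assoc]
    refine and_congr_right fun he => and_congr_right fun hze => ?_
    constructor
    · intro h x hx
      by_cases hxz : x = z
      · simp [hxz]
      · simp [h hx, hsubU e he hze (Finset.mem_erase.2 ⟨hxz, hx⟩)]
    · intro h x hx
      rcases Finset.mem_insert.1 (h hx) with rfl | hx
      · exact hzS
      · exact (Finset.mem_inter.1 hx).1
  have hz₂ (S : Finset V) (hUS : U ⊆ S) :
      (∃ e ∈ A, z ∉ e ∧ e ⊆ S) ↔ t₂ - ∑ v ∈ U, w₂ v ≤ ∑ v ∈ (S \ U).erase z, w₂ v := by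
    have hdisj : Disjoint U ((S \ U).erase z) :=
      Finset.disjoint_left.2 fun x hx hx' => by simp [hx] at hx'
    have := h₂ (U ∪ (S \ U).erase z)
    rw [Finset.sum_union hdisj] at this
    rw [Nat.sub_le_iff_le_add', ← this]
    refine exists_congr fun e => ?_
    rw [Finset.mem_filter, and_assoc]
    refine and_congr_right fun he => and_congr_right fun hze => ?_
    constructor
    · intro h x hx
      by_cases hxU : x ∈ U
      · simp [hxU]
      · simp [hxU, h hx, show x ≠ z from fun H => hze (H ▸ hx)]
    · intro h x hx
      rcases Finset.mem_union.1 (h hx) with hx | hx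
      · exact hUS hx
      · exact (Finset.mem_sdiff.1 (Finset.mem_of_mem_erase hx)).1
  set s₁ := t₁ - w₁ z
  set s₂ := t₂ - ∑ v ∈ U, w₂ v
  -- `k` is the surplus of the full weight of `U` over what is needed together with `z`.
  obtain ⟨k, hk⟩ : ∃ k, ∑ v ∈ U, w₁ v = s₁ + k := by
    refine Nat.exists_eq_add_of_le ?_
    obtain ⟨e, he, hze⟩ := hz
    have := (hz₁ Finset.univ (Finset.mem_univ z)).1 ⟨e, he, hze, Finset.subset_univ e⟩
    rwa [Finset.univ_inter] at this
  set M := 1 + ∑ v, w₂ v with hM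
  -- As `M` exceeds every `w₂`-sum, weight on `U` dominates lexicographically. With `z` present the
  -- test becomes `s₁ ≤ w₁(S ∩ U)`. Without `z` it forces `U ⊆ S`, by positivity of `w₁` on `U`, and
  -- then tests `s₂` on the rest.
  refine ⟨fun v => if v = z then M * k + s₂ else if v ∈ U then M * w₁ v else w₂ v,
    M * (s₁ + k) + s₂, fun S => ?_⟩
  have hex : (∃ e ∈ A, e ⊆ S) ↔ (∃ e ∈ A, z ∈ e ∧ e ⊆ S) ∨ (∃ e ∈ A, z ∉ e ∧ e ⊆ S) := by
    rw [← exists_or]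
    refine exists_congr fun e => ?_
    tauto
  have hsum : ∑ v ∈ S, (if v = z then M * k + s₂ else if v ∈ U then M * w₁ v else w₂ v) =
      (if z ∈ S then M * k + s₂ else 0) + M * ∑ v ∈ S ∩ U, w₁ v +
        ∑ v ∈ (S \ U).erase z, w₂ v := by
    rw [← Finset.sum_inter_add_sum_sdiff S U, Finset.mul_sum]
    have hI : ∑ v ∈ S ∩ U, (if v = z then M * k + s₂ else if v ∈ U then M * w₁ v else w₂ v) =
        ∑ v ∈ S ∩ U, M * w₁ v := by
      refine Finset.sum_congr rfl fun v hv => ?_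
      have hvU := (Finset.mem_inter.1 hv).2
      rw [if_neg (fun H : v = z => hzU (H ▸ hvU)), if_pos hvU]
    have hD : ∑ v ∈ (S \ U).erase z,
        (if v = z then M * k + s₂ else if v ∈ U then M * w₁ v else w₂ v) =
        ∑ v ∈ (S \ U).erase z, w₂ v := by
      refine Finset.sum_congr rfl fun v hv => ?_
      obtain ⟨hvz, hv⟩ := Finset.mem_erase.1 hv
      rw [if_neg hvz, if_neg (Finset.mem_sdiff.1 hv).2]
    rw [hI]
    by_cases hzS : z ∈ S
    · rw [← Finset.add_sum_erase (S \ U) _ (Finset.mem_sdiff.2 ⟨hzS, hzU⟩), hD]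
      simp only [hzS, if_true]
      ring
    · rw [if_neg hzS, zero_add, ← hD, Finset.erase_eq_of_notMem (by simp [hzS])]
  have hQ : ∑ v ∈ (S \ U).erase z, w₂ v < M := by
    have := Finset.sum_le_sum_of_subset (f := w₂) (Finset.subset_univ ((S \ U).erase z))
    omega
  have hP : ¬ U ⊆ S → ∑ v ∈ S ∩ U, w₁ v + 1 ≤ s₁ + k := by
    intro h
    obtain ⟨x, hxU, hxS⟩ := Finset.not_subset.1 h
    rw [← hk]
    exact Finset.sum_lt_sum_of_subset Finset.inter_subset_right hxU (by simp [hxS])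
      (hpos x hxU) (fun _ _ _ => Nat.zero_le _)
  have hPU : U ⊆ S → ∑ v ∈ S ∩ U, w₁ v = s₁ + k := by
    intro h
    rw [Finset.inter_eq_right.2 h, hk]
  have hUS : (∃ e ∈ A, z ∉ e ∧ e ⊆ S) → U ⊆ S := fun ⟨e, he, hze, heS⟩ =>
    (hUsub e he hze).trans heS
  rw [hex, hsum]
  specialize hz₁ S
  specialize hz₂ S
  generalize ∑ v ∈ S ∩ U, w₁ v = p at *
  generalize ∑ v ∈ (S \ U).erase z, w₂ v = q at *
  by_cases hzS : z ∈ S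
  · rw [if_pos hzS, hz₁ hzS]
    by_cases hp : s₁ ≤ p
    · refine iff_of_true (Or.inl hp) ?_
      nlinarith [Nat.mul_le_mul_left M hp]
    · refine iff_of_false ?_ ?_
      · rintro (h | h)
        · exact hp h
        · have := hPU (hUS h)
          omega
      · have : M * (p + 1) ≤ M * s₁ := Nat.mul_le_mul_left M (by omega)
        nlinarith
  · have hno : ¬ ∃ e ∈ A, z ∈ e ∧ e ⊆ S := fun ⟨e, _, hze, heS⟩ => hzS (heS hze)
    rw [if_neg hzS, or_iff_right hno]
    by_cases hS : U ⊆ S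
    · rw [hz₂ hS, hPU hS]
      omega
    · refine iff_of_false (fun h => hS (hUS h)) ?_
      have : M * (p + 1) ≤ M * (s₁ + k) := Nat.mul_le_mul_left M (hP hS)
      nlinarith

theorem IsOneSperner.exists_separates {V : Type*} [Fintype V] [DecidableEq V]
    {A : Finset (Finset V)} (hA : IsOneSperner A) : ∃ w t, Separates A w t := by
  induction hn : A.card using Nat.strong_induction_on generalizing A with
  | _ n ih =>
  subst hn
  rcases lt_trichotomy A.card 1 with h | h | h
  · obtain rfl : A = ∅ := Finset.card_eq_zero.1 (by omega)
    exact ⟨0, 1, fun S => by simp⟩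
  · obtain ⟨e, rfl⟩ := Finset.card_eq_one.1 h
    exact ⟨_, _, separates_singleton e⟩
  · obtain ⟨z, ⟨e, he, hze⟩, ⟨f, hf, hzf⟩, hsplit⟩ := hA.exists_split h
    obtain ⟨w₁, t₁, h₁⟩ := ih _ (Finset.card_lt_card (Finset.filter_ssubset.2 ⟨f, hf, hzf⟩))
      (hA.mono (Finset.filter_subset (fun e => z ∈ e) A)) rfl
    obtain ⟨w₂, t₂, h₂⟩ := ih _ (Finset.card_lt_card
      (Finset.filter_ssubset.2 ⟨e, he, not_not.2 hze⟩))
      (hA.mono (Finset.filter_subset (fun e => z ∉ e) A)) rfl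
    exact hA.exists_separates_of_split ⟨e, he, hze⟩ hsplit h₁ h₂

/-! ### Minimal neighborhoods in graphs without forbidden induced subgraphs -/

theorem isIndContained_of_forall_lt {n : ℕ} {V : Type*} {G : SimpleGraph V}
    {H : SimpleGraph (Fin n)} (f : Fin n → V)
    (h : ∀ i j, i < j → f i ≠ f j ∧ (H.Adj i j ↔ G.Adj (f i) (f j))) : H.IsIndContained G := by
  have hinj : Function.Injective f := by
    intro i j hij
    rcases lt_trichotomy i j with hlt | heq | hlt
    · exact absurd hij (h i j hlt).1
    · exact heq
    · exact absurd hij.symm (h j i hlt).1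
  have hadj (i j : Fin n) : G.Adj (f i) (f j) ↔ H.Adj i j := by
    rcases lt_trichotomy i j with hlt | rfl | hlt
    · exact (h i j hlt).2.symm
    · simp
    · rw [H.adj_comm, G.adj_comm]
      exact (h j i hlt).2.symm
  exact ⟨⟨⟨f, hinj⟩, fun {i j} => hadj i j⟩⟩

theorem isIndContained_sum {V W X : Type*} {G : SimpleGraph V} {H : SimpleGraph W}
    {K : SimpleGraph X} (f : H ↪g G) (g : K ↪g G) (hfg : ∀ i j, f i ≠ g j ∧ ¬ G.Adj (f i) (g j)) :
    (H ⊕g K).IsIndContained G := by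
  have hinj : Function.Injective (Sum.elim f g) :=
    f.injective.sumElim g.injective fun i j => (hfg i j).1
  have hadj (i j : W ⊕ X) :
      G.Adj (Sum.elim f g i) (Sum.elim f g j) ↔ (H ⊕g K).Adj i j := by
    rcases i with i | i <;> rcases j with j | j
    · simp
    · simp [(hfg i j).2]
    · simp [G.adj_comm, (hfg j i).2]
    · simp
  exact ⟨⟨⟨_, hinj⟩, fun {i j} => hadj i j⟩⟩

/-- An induced path or triangle with middle vertex `1`. -/
theorem exists_embedding_three {V : Type*} {G : SimpleGraph V} {H : SimpleGraph (Fin 3)}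
    {a u b : V} (hab : a ≠ b) (hua : G.Adj u a) (hub : G.Adj u b) (h01 : H.Adj 0 1)
    (h12 : H.Adj 1 2) (h02 : H.Adj 0 2 ↔ G.Adj a b) : ∃ f : H ↪g G, ⇑f = ![a, u, b] := by
  have hinj : Function.Injective ![a, u, b] := by
    simp [Function.Injective, Fin.forall_fin_succ, hab, hab.symm, hua.ne, hua.ne', hub.ne, hub.ne']
  have hadj (i j : Fin 3) : G.Adj (![a, u, b] i) (![a, u, b] j) ↔ H.Adj i j := by
    revert i j
    simp [Fin.forall_fin_succ, hua, hua.symm, hub, hub.symm, h01, h01.symm, h12, h12.symm,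
      h02, H.adj_comm 2 0, G.adj_comm b a]
  exact ⟨⟨⟨_, hinj⟩, fun {i j} => hadj i j⟩, rfl⟩

/-- Two non-adjacent vertices `u`, `v`, each with two private neighbors. -/
structure PrivatePairs {V : Type*} (G : SimpleGraph V) (u v a b c d : V) : Prop where
  ne_ab : a ≠ b
  ne_cd : c ≠ d
  ne_uv : u ≠ v
  not_uv : ¬ G.Adj u v
  ua : G.Adj u a
  ub : G.Adj u b
  vc : G.Adj v c
  vd : G.Adj v d
  not_uc : ¬ G.Adj u c
  not_ud : ¬ G.Adj u d
  not_va : ¬ G.Adj v a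
  not_vb : ¬ G.Adj v b

namespace PrivatePairs

variable {V : Type*} {G : SimpleGraph V} {u v a b c d : V}

theorem swap_sides (h : PrivatePairs G u v a b c d) : PrivatePairs G v u c d a b := by
  obtain ⟨h1, h2, h3, h4, h5, h6, h7, h8, h9, h10, h11, h12⟩ := h
  exact ⟨h2, h1, h3.symm, fun h => h4 h.symm, h7, h8, h5, h6, h11, h12, h9, h10⟩

theorem swap_left (h : PrivatePairs G u v a b c d) : PrivatePairs G u v b a c d := by
  obtain ⟨h1, h2, h3, h4, h5, h6, h7, h8, h9, h10, h11, h12⟩ := h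
  exact ⟨h1.symm, h2, h3, h4, h6, h5, h7, h8, h9, h10, h12, h11⟩

theorem swap_right (h : PrivatePairs G u v a b c d) : PrivatePairs G u v a b d c :=
  h.swap_sides.swap_left.swap_sides

theorem pairwise_ne (h : PrivatePairs G u v a b c d) :
    (u ≠ a ∧ u ≠ b ∧ u ≠ c ∧ u ≠ d) ∧ (v ≠ a ∧ v ≠ b ∧ v ≠ c ∧ v ≠ d) ∧
      a ≠ c ∧ a ≠ d ∧ b ≠ c ∧ b ≠ d := by
  obtain ⟨h1, h2, h3, h4, h5, h6, h7, h8, h9, h10, h11, h12⟩ := h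
  have huv := h4
  rw [G.adj_comm] at huv
  refine ⟨⟨h5.ne, h6.ne, ?_, ?_⟩, ⟨?_, ?_, h7.ne, h8.ne⟩, ?_, ?_, ?_, ?_⟩ <;> rintro rfl <;>
    contradiction

end PrivatePairs

section

variable {V : Type*} {G : SimpleGraph V}

theorem IsFree.not_cycle_four (hF : IsFree forbidden G) {a b c d : V} (hac : a ≠ c) (hbd : b ≠ d)
    (hab : G.Adj a b) (hbc : G.Adj b c) (hcd : G.Adj c d) (hda : G.Adj d a)
    (nac : ¬ G.Adj a c) (nbd : ¬ G.Adj b d) : False := by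
  have := hab.ne
  have := hbc.ne
  have := hcd.ne
  have := hda.ne
  refine hF 0 (isIndContained_of_forall_lt (H := cycleGraph 4) ![a, b, c, d] ?_)
  simp [Fin.forall_fin_succ, cycleGraph_adj]
  grind [SimpleGraph.adj_comm]

/-- The cycles `u a c b` and `v c b d` need a chord, which forces the edges `ab` and `cd`. -/
theorem IsFree.not_complete_cross (hF : IsFree forbidden G) {u v a b c d : V}
    (h : PrivatePairs G u v a b c d)
    (hac : G.Adj a c) (had : G.Adj a d) (hbc : G.Adj b c) (hbd : G.Adj b d) : False := by
  have hn := h.pairwise_ne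
  obtain ⟨h1, h2, h3, h4, h5, h6, h7, h8, h9, h10, h11, h12⟩ := h
  have hab : G.Adj a b := by
    by_contra H
    exact hF.not_cycle_four hn.1.2.2.1 h1 h5 hac hbc.symm h6.symm h9 H
  have hcd : G.Adj c d := by
    by_contra H
    exact hF.not_cycle_four hn.2.1.2.1 h2 h7 hbc.symm hbd h8.symm h12 H
  refine hF 12 (isIndContained_of_forall_lt (H := F13) ![u, a, b, c, d, v] ?_)
  simp [Fin.forall_fin_succ, F13]
  grind [SimpleGraph.adj_comm]

theorem IsFree.not_three_cross (hF : IsFree forbidden G) {u v a b c d : V}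
    (h : PrivatePairs G u v a b c d)
    (hac : G.Adj a c) (hbc : G.Adj b c) (hbd : G.Adj b d) (nad : ¬ G.Adj a d) : False := by
  have hn := h.pairwise_ne
  obtain ⟨h1, h2, h3, h4, h5, h6, h7, h8, h9, h10, h11, h12⟩ := h
  have hab : G.Adj a b := by
    by_contra H
    exact hF.not_cycle_four hn.1.2.2.1 h1 h5 hac hbc.symm h6.symm h9 H
  have hcd : G.Adj c d := by
    by_contra H
    exact hF.not_cycle_four hn.2.1.2.1 h2 h7 hbc.symm hbd h8.symm h12 H
  refine hF 11 (isIndContained_of_forall_lt (H := F12) ![u, a, b, c, d, v] ?_)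
  simp [Fin.forall_fin_succ, F12]
  grind [SimpleGraph.adj_comm]

theorem IsFree.not_star_cross (hF : IsFree forbidden G) {u v a b c d : V}
    (h : PrivatePairs G u v a b c d)
    (hac : G.Adj a c) (hbc : G.Adj b c) (nad : ¬ G.Adj a d) (nbd : ¬ G.Adj b d) : False := by
  have hn := h.pairwise_ne
  obtain ⟨h1, h2, h3, h4, h5, h6, h7, h8, h9, h10, h11, h12⟩ := h
  have hab : G.Adj a b := by
    by_contra H
    exact hF.not_cycle_four hn.1.2.2.1 h1 h5 hac hbc.symm h6.symm h9 H
  by_cases hcd : G.Adj c d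
  · refine hF 10 (isIndContained_of_forall_lt (H := F11) ![u, a, b, c, v, d] ?_)
    simp [Fin.forall_fin_succ, F11]
    grind [SimpleGraph.adj_comm]
  · refine hF 8 (isIndContained_of_forall_lt (H := F9) ![u, a, b, c, v, d] ?_)
    simp [Fin.forall_fin_succ, F9]
    grind [SimpleGraph.adj_comm]

theorem IsFree.not_matching_cross (hF : IsFree forbidden G) {u v a b c d : V}
    (h : PrivatePairs G u v a b c d)
    (hac : G.Adj a c) (hbd : G.Adj b d) (nad : ¬ G.Adj a d) (nbc : ¬ G.Adj b c) : False := by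
  have hn := h.pairwise_ne
  obtain ⟨h1, h2, h3, h4, h5, h6, h7, h8, h9, h10, h11, h12⟩ := h
  by_cases hab : G.Adj a b <;> by_cases hcd : G.Adj c d
  · exact hF.not_cycle_four hn.2.2.2.1 hn.2.2.2.2.1.symm hac hcd hbd.symm hab.symm nad
      fun H => nbc H.symm
  · refine hF 1 (isIndContained_of_forall_lt (H := cycleGraph 5) ![a, c, v, d, b] ?_)
    simp [Fin.forall_fin_succ, cycleGraph_adj]
    grind [SimpleGraph.adj_comm]
  · refine hF 1 (isIndContained_of_forall_lt (H := cycleGraph 5) ![u, a, c, d, b] ?_)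
    simp [Fin.forall_fin_succ, cycleGraph_adj]
    grind [SimpleGraph.adj_comm]
  · refine hF 2 (isIndContained_of_forall_lt (H := cycleGraph 6) ![u, a, c, v, d, b] ?_)
    simp [Fin.forall_fin_succ, cycleGraph_adj]
    grind [SimpleGraph.adj_comm]

theorem IsFree.not_one_cross_of_adj (hF : IsFree forbidden G) {u v a b c d : V}
    (h : PrivatePairs G u v a b c d)
    (hac : G.Adj a c) (hab : G.Adj a b) (nad : ¬ G.Adj a d) (nbc : ¬ G.Adj b c)
    (nbd : ¬ G.Adj b d) : False := by
  have hn := h.pairwise_ne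
  obtain ⟨h1, h2, h3, h4, h5, h6, h7, h8, h9, h10, h11, h12⟩ := h
  by_cases hcd : G.Adj c d
  · refine hF 9 (isIndContained_of_forall_lt (H := F10) ![b, u, a, c, v, d] ?_)
    simp [Fin.forall_fin_succ, F10]
    grind [SimpleGraph.adj_comm]
  · refine hF 7 (isIndContained_of_forall_lt (H := F8) ![b, u, a, c, v, d] ?_)
    simp [Fin.forall_fin_succ, F8]
    grind [SimpleGraph.adj_comm]

theorem IsFree.not_one_cross (hF : IsFree forbidden G) {u v a b c d : V}
    (h : PrivatePairs G u v a b c d) (hac : G.Adj a c)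
    (nad : ¬ G.Adj a d) (nbc : ¬ G.Adj b c) (nbd : ¬ G.Adj b d) : False := by
  by_cases hab : G.Adj a b
  · exact hF.not_one_cross_of_adj h hac hab nad nbc nbd
  by_cases hcd : G.Adj c d
  · exact hF.not_one_cross_of_adj h.swap_sides hac.symm hcd (fun H => nbc H.symm)
      (fun H => nad H.symm) (fun H => nbd H.symm)
  have hn := h.pairwise_ne
  obtain ⟨h1, h2, h3, h4, h5, h6, h7, h8, h9, h10, h11, h12⟩ := h
  refine hF 3 (isIndContained_of_forall_lt (H := pathGraph 6) ![b, u, a, c, v, d] ?_)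
  simp [Fin.forall_fin_succ, pathGraph_adj]
  grind [SimpleGraph.adj_comm]

theorem IsFree.not_empty_cross (hF : IsFree forbidden G) {u v a b c d : V}
    (h : PrivatePairs G u v a b c d) (nac : ¬ G.Adj a c)
    (nad : ¬ G.Adj a d) (nbc : ¬ G.Adj b c) (nbd : ¬ G.Adj b d) : False := by
  have key {x y p q r s : V} (h : PrivatePairs G x y p q r s) (npr : ¬ G.Adj p r)
      (nps : ¬ G.Adj p s) (nqr : ¬ G.Adj q r) (nqs : ¬ G.Adj q s) {H K : SimpleGraph (Fin 3)}
      (h01 : H.Adj 0 1) (h12 : H.Adj 1 2) (h02 : H.Adj 0 2 ↔ G.Adj p q)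
      (k01 : K.Adj 0 1) (k12 : K.Adj 1 2) (k02 : K.Adj 0 2 ↔ G.Adj r s) :
      (H ⊕g K).IsIndContained G := by
    obtain ⟨f, hf⟩ := exists_embedding_three h.ne_ab h.ua h.ub h01 h12 h02
    obtain ⟨g, hg⟩ := exists_embedding_three h.ne_cd h.vc h.vd k01 k12 k02
    have hn := h.pairwise_ne
    obtain ⟨h1, h2, h3, h4, h5, h6, h7, h8, h9, h10, h11, h12⟩ := h
    refine isIndContained_sum f g ?_
    rw [hf, hg]
    simp [Fin.forall_fin_succ]
    grind [SimpleGraph.adj_comm]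
  by_cases hab : G.Adj a b <;> by_cases hcd : G.Adj c d
  · exact hF 6 (key (H := completeGraph (Fin 3)) (K := completeGraph (Fin 3)) h nac nad nbc nbd
      (by simp) (by simp) (by simp [hab]) (by simp) (by simp) (by simp [hcd]))
  · exact hF 5 (key (H := pathGraph 3) (K := completeGraph (Fin 3)) h.swap_sides
      (fun H => nac H.symm) (fun H => nbc H.symm) (fun H => nad H.symm) (fun H => nbd H.symm)
      (by simp [pathGraph_adj]) (by simp [pathGraph_adj]) (by simp [pathGraph_adj, hcd])
      (by simp) (by simp) (by simp [hab]))
  · exact hF 5 (key (H := pathGraph 3) (K := completeGraph (Fin 3)) h nac nad nbc nbd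
      (by simp [pathGraph_adj]) (by simp [pathGraph_adj]) (by simp [pathGraph_adj, hab])
      (by simp) (by simp) (by simp [hcd]))
  · exact hF 4 (key (H := pathGraph 3) (K := pathGraph 3) h nac nad nbc nbd
      (by simp [pathGraph_adj]) (by simp [pathGraph_adj]) (by simp [pathGraph_adj, hab])
      (by simp [pathGraph_adj]) (by simp [pathGraph_adj]) (by simp [pathGraph_adj, hcd]))

theorem IsFree.not_privatePairs (hF : IsFree forbidden G) {u v a b c d : V} :
    ¬ PrivatePairs G u v a b c d := by
  intro h
  have hs := h.swap_sides
  have flip {x y : V} (hxy : ¬ G.Adj x y) : ¬ G.Adj y x := fun H => hxy H.symm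
  -- Up to swapping sides and swapping within a side, the sixteen cross patterns reduce to six.
  by_cases hac : G.Adj a c <;> by_cases had : G.Adj a d <;> by_cases hbc : G.Adj b c <;>
    by_cases hbd : G.Adj b d
  · exact hF.not_complete_cross h hac had hbc hbd
  · exact hF.not_three_cross h.swap_left hbc hac had hbd
  · exact hF.not_three_cross h.swap_left.swap_right hbd had hac hbc
  · exact hF.not_star_cross hs hac.symm had.symm (flip hbc) (flip hbd)
  · exact hF.not_three_cross h hac hbc hbd had
  · exact hF.not_star_cross h hac hbc had hbd
  · exact hF.not_matching_cross h hac hbd had hbc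
  · exact hF.not_one_cross h hac had hbc hbd
  · exact hF.not_three_cross h.swap_right had hbd hbc hac
  · exact hF.not_matching_cross h.swap_right had hbc hac hbd
  · exact hF.not_star_cross h.swap_right had hbd hac hbc
  · exact hF.not_one_cross h.swap_right had hac hbd hbc
  · exact hF.not_star_cross hs.swap_right hbc.symm hbd.symm (flip hac) (flip had)
  · exact hF.not_one_cross h.swap_left hbc hbd hac had
  · exact hF.not_one_cross h.swap_left.swap_right hbd hbc had hac
  · exact hF.not_empty_cross h hac had hbc hbd

/-- No path `p b u v d q` whose chords are among `pu`, `pq`, `vq`, `bd`, `pd` and `bq`. -/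
theorem IsFree.not_long_path (hF : IsFree forbidden G) {p b u v d q : V} (hpb : G.Adj p b)
    (hbu : G.Adj b u) (huv : G.Adj u v) (hvd : G.Adj v d) (hdq : G.Adj d q) (hbv : b ≠ v)
    (hud : u ≠ d) (npv : ¬ G.Adj p v) (nbv : ¬ G.Adj b v) (nud : ¬ G.Adj u d)
    (nuq : ¬ G.Adj u q) : False := by
  have ne {x y z : V} (hxz : G.Adj x z) (hyz : ¬ G.Adj y z) : x ≠ y := fun H => hyz (H ▸ hxz)
  have flip {x y : V} (hxy : ¬ G.Adj x y) : ¬ G.Adj y x := fun H => hxy H.symm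
  have hbd : b ≠ d := (ne hvd.symm nbv).symm
  have hpu : p ≠ u := (ne huv npv).symm
  have hpv : p ≠ v := ne hpb (flip nbv)
  have hvq : v ≠ q := ne huv.symm (flip nuq)
  have huq : u ≠ q := (ne hdq.symm nud).symm
  have hpd : p ≠ d := (ne hvd.symm npv).symm
  have hbq : b ≠ q := ne hbu (flip nuq)
  -- The chords `bd`, `pd`, `bq` would create an induced `C_4` or `C_5`; only `pq`, `pu`, `vq` then
  -- stay undecided.
  have nbd : ¬ G.Adj b d := fun H =>
    hF.not_cycle_four hbv hud hbu huv hvd H.symm nbv nud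
  have npd : ¬ G.Adj p d := by
    intro H
    by_cases npu : G.Adj p u
    · exact hF.not_cycle_four hpv hud npu huv hvd H.symm npv nud
    refine hF 1 (isIndContained_of_forall_lt (H := cycleGraph 5) ![p, b, u, v, d] ?_)
    simp [Fin.forall_fin_succ, cycleGraph_adj]
    grind [SimpleGraph.adj_comm]
  have nbq : ¬ G.Adj b q := by
    intro H
    by_cases nvq : G.Adj v q
    · exact hF.not_cycle_four hbv huq hbu huv nvq H.symm nbv nuq
    refine hF 1 (isIndContained_of_forall_lt (H := cycleGraph 5) ![b, u, v, d, q] ?_)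
    simp [Fin.forall_fin_succ, cycleGraph_adj]
    grind [SimpleGraph.adj_comm]
  have hpq : p ≠ q := ne hpb (flip nbq)
  have := hpb.ne
  have := hbu.ne
  have := huv.ne
  have := hvd.ne
  have := hdq.ne
  by_cases hpq' : G.Adj p q <;> by_cases hpu' : G.Adj p u <;> by_cases hvq' : G.Adj v q
  · exact hF.not_cycle_four hpv huq hpu' huv hvq' hpq'.symm npv nuq
  · refine hF 1 (isIndContained_of_forall_lt (H := cycleGraph 5) ![p, u, v, d, q] ?_)
    simp [Fin.forall_fin_succ, cycleGraph_adj]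
    grind [SimpleGraph.adj_comm]
  · refine hF 1 (isIndContained_of_forall_lt (H := cycleGraph 5) ![p, b, u, v, q] ?_)
    simp [Fin.forall_fin_succ, cycleGraph_adj]
    grind [SimpleGraph.adj_comm]
  · refine hF 2 (isIndContained_of_forall_lt (H := cycleGraph 6) ![p, b, u, v, d, q] ?_)
    simp [Fin.forall_fin_succ, cycleGraph_adj]
    grind [SimpleGraph.adj_comm]
  · refine hF 9 (isIndContained_of_forall_lt (H := F10) ![p, b, u, v, d, q] ?_)
    simp [Fin.forall_fin_succ, F10]
    grind [SimpleGraph.adj_comm]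
  · refine hF 7 (isIndContained_of_forall_lt (H := F8) ![p, b, u, v, d, q] ?_)
    simp [Fin.forall_fin_succ, F8]
    grind [SimpleGraph.adj_comm]
  · refine hF 7 (isIndContained_of_forall_lt (H := F8) ![q, d, v, u, b, p] ?_)
    simp [Fin.forall_fin_succ, F8]
    grind [SimpleGraph.adj_comm]
  · refine hF 3 (isIndContained_of_forall_lt (H := pathGraph 6) ![p, b, u, v, d, q] ?_)
    simp [Fin.forall_fin_succ, pathGraph_adj]
    grind [SimpleGraph.adj_comm]

end

section

variable {V : Type*} [Fintype V] [DecidableEq V] {G : SimpleGraph V} [DecidableRel G.Adj]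

/-- Two inclusion-minimal neighborhoods cannot both have two private elements. -/
theorem IsFree.card_sdiff_le_one_of_minimal (hF : IsFree forbidden G) {u v : V}
    (hu : ∀ w, G.neighborFinset w ⊆ G.neighborFinset u → G.neighborFinset w = G.neighborFinset u)
    (hv : ∀ w, G.neighborFinset w ⊆ G.neighborFinset v → G.neighborFinset w = G.neighborFinset v) :
    (G.neighborFinset u \ G.neighborFinset v).card ≤ 1 ∨
      (G.neighborFinset v \ G.neighborFinset u).card ≤ 1 := by
  by_contra! H
  obtain ⟨H₁, H₂⟩ := H
  -- In the adjacent case `u` and `v` are themselves private elements. Only here is minimality used: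
  -- it extends the path `b u v d` at both ends.
  by_cases huv : G.Adj u v
  · obtain ⟨b, hb, hbv⟩ := Finset.exists_mem_ne H₁ v
    obtain ⟨d, hd, hdu⟩ := Finset.exists_mem_ne H₂ u
    simp only [Finset.mem_sdiff, mem_neighborFinset] at hb hd
    have hbd : ¬ G.Adj b d := fun H => hF.not_cycle_four hbv hdu.symm hb.1.symm huv hd.1 H.symm
      (fun h => hb.2 h.symm) hd.2
    have escape {x y z : V} (hy : ∀ w, G.neighborFinset w ⊆ G.neighborFinset y →
        G.neighborFinset w = G.neighborFinset y) (hyz : G.Adj y z) (hxz : ¬ G.Adj x z) :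
        ∃ p, G.Adj x p ∧ ¬ G.Adj y p := by
      by_contra! H
      have := hy x fun p hp => by
        rw [mem_neighborFinset] at hp ⊢
        exact H p hp
      rw [← mem_neighborFinset, this, mem_neighborFinset] at hxz
      exact hxz hyz
    obtain ⟨p, hp, hvp⟩ := escape hv hd.1 hbd
    obtain ⟨q, hq, huq⟩ := escape hu hb.1 (fun h => hbd h.symm)
    exact hF.not_long_path hp.symm hb.1.symm huv hd.1 hq hbv hdu.symm (fun h => hvp h.symm)
      (fun h => hb.2 h.symm) hd.2 huq
  · obtain ⟨a, ha, b, hb, hab⟩ := Finset.one_lt_card.1 H₁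
    obtain ⟨c, hc, d, hd, hcd⟩ := Finset.one_lt_card.1 H₂
    simp only [Finset.mem_sdiff, mem_neighborFinset] at ha hb hc hd
    exact hF.not_privatePairs (u := u) (v := v) ⟨hab, hcd, fun h => ha.2 (h ▸ ha.1), huv, ha.1,
      hb.1, hc.1, hd.1, hc.2, hd.2, ha.2, hb.2⟩

/-- The inclusion-minimal neighborhoods of `G`. -/
def minimalNeighborhoods (G : SimpleGraph V) [DecidableRel G.Adj] : Finset (Finset V) :=
  {e ∈ Finset.univ.image fun v => G.neighborFinset v |
    ∀ w, G.neighborFinset w ⊆ e → G.neighborFinset w = e}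

theorem mem_minimalNeighborhoods {e : Finset V} : e ∈ minimalNeighborhoods G ↔
    (∃ v, G.neighborFinset v = e) ∧ ∀ w, G.neighborFinset w ⊆ e → G.neighborFinset w = e := by
  simp [minimalNeighborhoods]

theorem exists_minimalNeighborhood_subset (G : SimpleGraph V) [DecidableRel G.Adj] (v : V) :
    ∃ e ∈ minimalNeighborhoods G, e ⊆ G.neighborFinset v := by
  obtain ⟨u, hu, hmin⟩ := Finset.exists_min_image
    ({u | G.neighborFinset u ⊆ G.neighborFinset v} : Finset V)
    (fun u => (G.neighborFinset u).card) ⟨v, by simp⟩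
  rw [Finset.mem_filter] at hu
  refine ⟨_, mem_minimalNeighborhoods.2 ⟨⟨u, rfl⟩, fun w hw => ?_⟩, hu.2⟩
  exact Finset.eq_of_subset_of_card_le hw
    (hmin w (Finset.mem_filter.2 ⟨Finset.mem_univ _, hw.trans hu.2⟩))

theorem IsFree.isOneSperner_minimalNeighborhoods (hF : IsFree forbidden G) :
    IsOneSperner (minimalNeighborhoods G) := by
  intro e he f hf hef
  obtain ⟨⟨u, rfl⟩, hu⟩ := mem_minimalNeighborhoods.1 he
  obtain ⟨⟨v, rfl⟩, hv⟩ := mem_minimalNeighborhoods.1 hf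
  refine ⟨?_, hF.card_sdiff_le_one_of_minimal hu hv⟩
  rw [Finset.sdiff_nonempty]
  exact fun h => hef (hv u h)

/-- Domination fails at `v` exactly when the neighborhood of `v` misses `S`, and every neighborhood
contains a minimal one. -/
theorem isTotalDominating_iff_not_exists (G : SimpleGraph V) [DecidableRel G.Adj]
    (S : Finset V) : IsTotalDominating G S ↔ ¬ ∃ e ∈ minimalNeighborhoods G, e ⊆ Sᶜ := by
  rw [← not_iff_not, not_not]
  constructor
  · intro h
    simp only [IsTotalDominating, not_forall] at h
    obtain ⟨v, hv⟩ := h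
    obtain ⟨e, he, hev⟩ := exists_minimalNeighborhood_subset G v
    refine ⟨e, he, fun x hx => Finset.mem_compl.2 fun hxS => hv ⟨x, hxS, ?_⟩⟩
    exact (mem_neighborFinset ..).1 (hev hx)
  · rintro ⟨e, he, heS⟩ h
    obtain ⟨⟨v, rfl⟩, -⟩ := mem_minimalNeighborhoods.1 he
    obtain ⟨x, hxS, hvx⟩ := h v
    exact Finset.mem_compl.1 (heS ((mem_neighborFinset ..).2 hvx)) hxS

end

theorem IsFree.isTotalDomishold {V : Type*} [Finite V] {G : SimpleGraph V}
    (hF : IsFree forbidden G) : IsTotalDomishold G := by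
  classical
  have := Fintype.ofFinite V
  obtain ⟨w, t, hw⟩ := hF.isOneSperner_minimalNeighborhoods.exists_separates
  -- Weights are integers, so `w(Sᶜ) < t` means `w(V) + 1 - t ≤ w(S)`. The maximum with `0` only
  -- keeps the threshold non-negative.
  refine ⟨fun v => w v, max 0 (∑ v, (w v : ℝ) + 1 - t), fun v => Nat.cast_nonneg _,
    le_max_left _ _, fun S => ?_⟩
  have hadd : ∑ v ∈ S, w v + ∑ v ∈ Sᶜ, w v = ∑ v, w v := Finset.sum_add_sum_compl S w
  rw [isTotalDominating_iff_not_exists, hw Sᶜ, max_le_iff,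
    and_iff_right (Finset.sum_nonneg fun v _ => Nat.cast_nonneg _), sub_le_iff_le_add,
    ← Nat.cast_sum, ← Nat.cast_sum]
  norm_cast
  omega

theorem IsFree.induce {V : Type*} {ι : Type*} {F : ι → Σ W : Type, SimpleGraph W}
    {G : SimpleGraph V} (hF : IsFree F G) (s : Set V) : IsFree F (G.induce s) :=
  fun i hi => hF i (hi.trans ⟨Embedding.induce s⟩)

end TotalDomishold

theorem mainTheorem1 {V : Type*} [Finite V] (G : SimpleGraph V) :
    List.TFAE [
      TotalDomishold.IsHereditaryTotalDomishold G,
      TotalDomishold.IsHereditaryTwoAsummable G,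
      TotalDomishold.IsFree TotalDomishold.forbidden G] := by
  tfae_have 1 → 2 := fun h s => (h s).isAsummable 2
  tfae_have 2 → 3 := fun h => h.isFree
  tfae_have 3 → 1 := fun h s => (h.induce s).isTotalDomishold
  tfae_finish
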